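/- All schemes are schemes over $\mathbb{C}$. Let $f : X \to Y$ be a finite flat morphism of schemes over $\mathbb{C}$, of constant degree $c \ge 1$ (that is, for every $y \in Y$ the stalk $(f_*\mathcal{O}_X)_y$ is a free $\mathcal{O}_{Y,y}$-module of rank $c$). There is exactly one morphism of $\mathcal{O}_Y$-modules $\mathrm{Tr} : f_*\mathcal{O}_X \to \mathcal{O}_Y$ such that, for every affine open $U \subseteq Y$ for which $\Gamma(f^{-1}U, \mathcal{O}_X)$ is a free $\Gamma(U, \mathcal{O}_Y)$-module and every $s \in \Gamma(f^{-1}U, \mathcal{O}_X)$, the section $\mathrm{Tr}(s)$ is the trace of the $\Gamma(U, \mathcal{O}_Y)$-linear endomorphism of $\Gamma(f^{-1}U, \mathcal{O}_X)$ given by multiplication by $s$. Let $i : \mathcal{O}_Y \to f_*\mathcal{O}_X$ be the canonical morphism and $p = \tfrac{1}{c}\,\mathrm{Tr}$. Then $p \circ i = \mathrm{id}_{\mathcal{O}_Y}$. Moreover, let $L$ be a locally free sheaf on $Y$ and $q \ge 0$. Then the $\mathbb{C}$-vector space $H^q(Y, L)$ is a direct summand of $H^q(Y, L \otimes_{\mathcal{O}_Y}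 f_*\mathcal{O}_X)$. More precisely, with the canonical identification $L \otimes \mathcal{O}_Y \cong L$, the composite of the $\mathbb{C}$-linear maps induced by $\mathrm{id}_L \otimes i$ and $\mathrm{id}_L \otimes p$, $$H^q(Y, L) \to H^q(Y, L \otimes f_*\mathcal{O}_X) \to H^q(Y, L),$$ is the identity of $H^q(Y, L)$. -/

import Mathlib

open CategoryTheory AlgebraicGeometry TopologicalSpace MonoidalCategory

namespace SchemeModules

noncomputable section

/-! ### The structure sheaf, the tensor product and direct images -/

/-- The structure sheaf `𝒪_Y`, as an `𝒪_Y`-module. -/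
def structureSheaf (Y : Scheme.{0}) : Y.Modules := SheafOfModules.unit Y.ringCatSheaf

/-- The direct image `f_* 𝒪_X` of the structure sheaf, as an `𝒪_Y`-module. -/
def directImage {X Y : Scheme.{0}} (f : X ⟶ Y) : Y.Modules :=
  (Scheme.Modules.pushforward f).obj (structureSheaf X)

/-- The canonical `𝒪_Y`-linear morphism `𝒪_Y ⟶ f_* 𝒪_X`, given on `U` by the ring homomorphism
`f.app U : Γ(Y, U) ⟶ Γ(X, f ⁻¹ᵁ U)`. -/
def structureMap {X Y : Scheme.{0}} (f : X ⟶ Y) : structureSheaf Y ⟶ directImage f :=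
  SheafOfModules.unitToPushforwardObjUnit f.toRingCatSheafHom

lemma structureMap_app_apply {X Y : Scheme.{0}} (f : X ⟶ Y) (U : Y.Opens) (a : Γ(Y, U)) :
    (structureMap f).app U a = f.app U a := rfl

/-- The forgetful functor from `𝒪_Y`-modules to presheaves of modules over the presheaf of
commutative rings `𝒪_Y` (on the latter Mathlib has the sectionwise tensor product). -/
def toPresheaf (Y : Scheme.{0}) :
    Y.Modules ⥤ _root_.PresheafOfModules (Y.presheaf ⋙ forget₂ CommRingCat RingCat) :=
  SheafOfModules.forget Y.ringCatSheaf

/-- The sheaf of `𝒪_Y`-modules associated to a presheaf of `𝒪_Y`-modules. -/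
def sheafification (Y : Scheme.{0}) :
    _root_.PresheafOfModules (Y.presheaf ⋙ forget₂ CommRingCat RingCat) ⥤ Y.Modules :=
  show Y.PresheafOfModules ⥤ Y.Modules from
    PresheafOfModules.sheafification (𝟙 Y.ringCatSheaf.obj)

/-- Sheafification is left adjoint to the forgetful functor. -/
def sheafificationAdjunction (Y : Scheme.{0}) : sheafification Y ⊣ toPresheaf Y :=
  (PresheafOfModules.sheafificationAdjunction (𝟙 Y.ringCatSheaf.obj)).ofNatIsoRight (Iso.refl _)

instance (Y : Scheme.{0}) : (toPresheaf Y).Full :=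
  (SheafOfModules.fullyFaithfulForget Y.ringCatSheaf).full

instance (Y : Scheme.{0}) : (toPresheaf Y).Faithful :=
  (SheafOfModules.fullyFaithfulForget Y.ringCatSheaf).faithful

/-- The tensor product `M ⊗_{𝒪_Y} N`: the sheaf associated to the presheaf
`U ↦ Γ(M, U) ⊗_{Γ(Y, U)} Γ(N, U)`. -/
def tensorProduct {Y : Scheme.{0}} (M N : Y.Modules) : Y.Modules :=
  (sheafification Y).obj ((toPresheaf Y).obj M ⊗ (toPresheaf Y).obj N)

/-- The morphism `id_M ⊗ φ : M ⊗ N ⟶ M ⊗ N'` induced by `φ : N ⟶ N'`. -/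
def tensorMap {Y : Scheme.{0}} (M : Y.Modules) {N N' : Y.Modules} (φ : N ⟶ N') :
    tensorProduct M N ⟶ tensorProduct M N' :=
  (sheafification Y).map ((toPresheaf Y).obj M ◁ (toPresheaf Y).map φ)

/-- The sectionwise isomorphism `s ⊗ a ↦ a • s` between the presheaf tensor product of `M`
with `𝒪_Y` and `M`. -/
def presheafTensorUnitIso {Y : Scheme.{0}} (M : Y.Modules) :
    (toPresheaf Y).obj M ⊗ (toPresheaf Y).obj (structureSheaf Y) ≅ (toPresheaf Y).obj M :=
  ρ_ ((toPresheaf Y).obj M)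

/-- The canonical isomorphism `M ⊗ 𝒪_Y ≅ M`, `s ⊗ a ↦ a • s`. -/
def tensorUnitIso {Y : Scheme.{0}} (M : Y.Modules) : tensorProduct M (structureSheaf Y) ≅ M :=
  (sheafification Y).mapIso (presheafTensorUnitIso M) ≪≫
    (asIso (sheafificationAdjunction Y).counit).app M

/-! ### The `ℂ`-linear structure on `𝒪_Y`-modules, for a scheme `Y` over `ℂ` -/

section Complex

variable (Y : Scheme.{0}) [Y.Over (Spec (.of ℂ))]

/-- The structural ring homomorphism `ℂ → Γ(Y, U)`. -/
def scalars (U : Y.Opens) : ℂ →+* Γ(Y, U) :=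
  ((Scheme.ΓSpecIso (.of ℂ)).inv ≫ (Y ↘ Spec (.of ℂ)).appTop ≫
    Y.presheaf.map (homOfLE (le_top : U ≤ ⊤)).op).hom

variable {Y}

lemma map_scalars {U V : Y.Opens} (i : U ⟶ V) (a : ℂ) :
    Y.presheaf.map i.op (scalars Y V a) = scalars Y U a := by
  simp only [scalars, CommRingCat.hom_comp, RingHom.comp_apply]
  rw [← CommRingCat.comp_apply, ← Functor.map_comp]
  rfl

/-- Multiplication by a complex number, as an endomorphism of an `𝒪_Y`-module. -/
def scalarEnd (M : Y.Modules) (a : ℂ) : M ⟶ M :=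
  SheafOfModules.Hom.mk (PresheafOfModules.homMk
    { app := fun U ↦ M.smul (scalars Y U.unop a)
      naturality := fun U V i ↦ by
        have := M.map_comp_smul i.unop (scalars Y U.unop a)
        rw [map_scalars] at this
        exact this.symm }
    (fun U r m ↦ by
      change scalars Y U.unop a • ((show Γ(Y, U.unop) from r) • (show Γ(M, U.unop) from m)) =
        (show Γ(Y, U.unop) from r) • (scalars Y U.unop a • (show Γ(M, U.unop) from m))
      rw [smul_smul, smul_smul, mul_comm]))

lemma scalarEnd_app_apply (M : Y.Modules) (a : ℂ) (U : Y.Opens) (s : Γ(M, U)) :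
    (scalarEnd M a).app U s = scalars Y U a • s := rfl

/-- `(a • φ)(s) = a • φ(s)` on sections. -/
instance (M N : Y.Modules) : SMul ℂ (M ⟶ N) := ⟨fun a φ ↦ φ ≫ scalarEnd N a⟩

lemma smul_app_apply {M N : Y.Modules} (a : ℂ) (φ : M ⟶ N) (U : Y.Opens) (s : Γ(M, U)) :
    (a • φ).app U s = scalars Y U a • φ.app U s := rfl

instance (M N : Y.Modules) : Module ℂ (M ⟶ N) where
  one_smul φ := by ext U s; simp [smul_app_apply]
  mul_smul a b φ := by ext U s; simp [smul_app_apply, mul_smul]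
  smul_zero a := by ext U s; simp [smul_app_apply]
  smul_add a φ ψ := by ext U s; simp [smul_app_apply]
  add_smul a b φ := by ext U s; simp [smul_app_apply, add_smul]
  zero_smul φ := by ext U s; simp [smul_app_apply]

instance : Linear ℂ Y.Modules where
  smul_comp M N K a φ ψ := by ext U s; simp [smul_app_apply]
  comp_smul M N K φ a ψ := by ext U s; simp [smul_app_apply]

end Complex

/-! ### Cohomology -/

/-- The functor `H^q(Y, -)` from `𝒪_Y`-modules to abelian groups: Mathlib's sheaf cohomology of
the underlying sheaf of abelian groups on the topological space `Y`. -/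
def cohomologyFunctor (Y : Scheme.{0}) (q : ℕ) : Y.Modules ⥤ AddCommGrpCat.{0} :=
  SheafOfModules.toSheaf Y.ringCatSheaf ⋙ Sheaf.functorH (Opens.grothendieckTopology Y) q

instance (Y : Scheme.{0}) (q : ℕ) : (cohomologyFunctor Y q).Additive :=
  inferInstanceAs (SheafOfModules.toSheaf Y.ringCatSheaf ⋙
    Sheaf.functorH (Opens.grothendieckTopology Y) q).Additive

/-- The cohomology group `H^q(Y, M)`. -/
def Cohomology {Y : Scheme.{0}} (q : ℕ) (M : Y.Modules) : Type := (cohomologyFunctor Y q).obj M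

instance {Y : Scheme.{0}} (q : ℕ) (M : Y.Modules) : AddCommGroup (Cohomology q M) :=
  inferInstanceAs (AddCommGroup ((cohomologyFunctor Y q).obj M))

section

variable {Y : Scheme.{0}} [Y.Over (Spec (.of ℂ))]

/-- The `ℂ`-vector space structure of `H^q(Y, M)`: the complex number `a` acts by
the map that multiplication by `a` on `M` induces in cohomology. -/
instance (q : ℕ) (M : Y.Modules) : Module ℂ (Cohomology q M) where
  smul a x := ((cohomologyFunctor Y q).map (a • 𝟙 M)).hom x
  one_smul x := by
    change ((cohomologyFunctor Y q).map ((1 : ℂ) • 𝟙 M)).hom x = x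
    rw [one_smul, CategoryTheory.Functor.map_id]
    rfl
  mul_smul a b x := by
    change ((cohomologyFunctor Y q).map ((a * b) • 𝟙 M)).hom x =
      ((cohomologyFunctor Y q).map (a • 𝟙 M)).hom (((cohomologyFunctor Y q).map (b • 𝟙 M)).hom x)
    have : (a * b) • 𝟙 M = (b • 𝟙 M) ≫ (a • 𝟙 M) := by simp [smul_smul]
    rw [this, Functor.map_comp]
    rfl
  smul_zero a := map_zero _
  smul_add a x y := map_add _ x y
  add_smul a b x := by
    change ((cohomologyFunctor Y q).map ((a + b) • 𝟙 M)).hom x =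
      ((cohomologyFunctor Y q).map (a • 𝟙 M)).hom x + ((cohomologyFunctor Y q).map (b • 𝟙 M)).hom x
    rw [add_smul, Functor.map_add]
    rfl
  zero_smul x := by
    change ((cohomologyFunctor Y q).map ((0 : ℂ) • 𝟙 M)).hom x = 0
    rw [zero_smul, Functor.map_zero]
    rfl

/-- The `ℂ`-linear map `H^q(Y, M) → H^q(Y, N)` induced by a morphism `M ⟶ N`. -/
def cohomologyMap (q : ℕ) {M N : Y.Modules} (φ : M ⟶ N) :
    Cohomology q M →ₗ[ℂ] Cohomology q N where
  toFun x := ((cohomologyFunctor Y q).map φ).hom x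
  map_add' x y := map_add _ x y
  map_smul' a x := by
    change ((cohomologyFunctor Y q).map φ).hom (((cohomologyFunctor Y q).map (a • 𝟙 M)).hom x) =
      ((cohomologyFunctor Y q).map (a • 𝟙 N)).hom (((cohomologyFunctor Y q).map φ).hom x)
    have h : (a • 𝟙 M) ≫ φ = φ ≫ (a • 𝟙 N) := by simp
    have := congr((cohomologyFunctor Y q).map $h)
    rw [Functor.map_comp, Functor.map_comp] at this
    exact congr(($this).hom x)

end

/-! ### The trace -/

/-- `t` is the trace morphism `f_* 𝒪_X ⟶ 𝒪_Y` of a finite locally free morphism `f`: over every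
affine open `U` of `Y` such that `Γ(X, f ⁻¹ᵁ U)` is a free `Γ(Y, U)`-module, it sends `s` to the
trace of the `Γ(Y, U)`-linear endomorphism "multiplication by `s`" of `Γ(X, f ⁻¹ᵁ U)`. -/
def IsTraceMorphism {X Y : Scheme.{0}} (f : X ⟶ Y) (t : directImage f ⟶ structureSheaf Y) : Prop :=
  ∀ U : Y.Opens, IsAffineOpen U →
    letI : Algebra Γ(Y, U) Γ(X, f ⁻¹ᵁ U) := (f.app U).hom.toAlgebra
    Module.Free Γ(Y, U) Γ(X, f ⁻¹ᵁ U) →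
      ∀ s : Γ(X, f ⁻¹ᵁ U), t.app U s = Algebra.trace Γ(Y, U) Γ(X, f ⁻¹ᵁ U) s

/-- The `R`-module `M` is a direct summand of the `R`-module `N`: some `R`-linear map `M → N`
has an `R`-linear left inverse. -/
def IsDirectSummand (R M N : Type*) [Ring R] [AddCommGroup M] [AddCommGroup N] [Module R M]
    [Module R N] : Prop :=
  ∃ (i : M →ₗ[R] N) (p : N →ₗ[R] M), p ∘ₗ i = LinearMap.id

end

end SchemeModules

/-! On a free algebra of rank `c`, multiplication by a scalar `r` has trace `c * r`, and `c` is
invertible over `ℂ`; so the trace divided by `c` retracts `𝒪_Y ⟶ f_* 𝒪_X`. Functors preserve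
retractions, here `L ⊗ -` followed by `H^q`, so the cohomological statement is formal.

The work lies in constructing the trace. Finiteness, flatness and constant degree give a basis of
affine opens over which `f_* 𝒪_X` is free (`exists_isTrivializing`). There the algebraic trace
commutes with restriction, because it commutes with base change (`IsTrivializing.map_trace`). The
relation `IsTraceOf` pins down the trace of a section over any open: uniqueness is separatedness of
`𝒪_Y`, existence is gluing. Linearity, naturality and uniqueness of the trace morphism all follow
from `IsTraceOf.unique`. -/

open scoped TensorProduct

/-! ### Commutative algebra: traces under base change, local freeness. -/

namespace Algebra.IsPushout

variable (R S R' S' : Type*) [CommRing R] [CommRing S] [CommRing R'] [CommRing S']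
  [Algebra R S] [Algebra R R'] [Algebra S S'] [Algebra R' S'] [Algebra R S']
  [IsScalarTower R R' S'] [IsScalarTower R S S'] [Algebra.IsPushout R R' S S']

include R S

/-- The trace of a finite free algebra commutes with base change. -/
lemma trace_algebraMap [Module.Free R S] [Module.Finite R S] (s : S) :
    Algebra.trace R' S' (algebraMap S S' s) = algebraMap R R' (Algebra.trace R S s) := by
  -- The isomorphism `R' ⊗[R] S ≃ S'` turns multiplication by the image of `s` into the base change
  -- of multiplication by `s`.
  have h : Algebra.trace R' S' (algebraMap S S' s) =
      Algebra.trace R' (R' ⊗[R] S) ((1 : R') ⊗ₜ[R] s) := by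
    rw [← Algebra.trace_eq_of_algEquiv (Algebra.IsPushout.equiv R R' S S')]
    congr 1
    simp [Algebra.IsPushout.equiv_tmul]
  rw [h, Algebra.trace_apply, Algebra.trace_apply, ← LinearMap.trace_baseChange]
  congr 1
  ext
  simp

end Algebra.IsPushout

namespace Module

/-- If a finite flat module has constant rank, every prime has a basic open neighbourhood over
which the base change of the module is free. -/
lemma exists_notMem_free_of_rankAtStalk_eq {R M : Type*} [CommRing R] [AddCommGroup M] [Module R M]
    [Module.Finite R M] [Module.Flat R M] (n : ℕ)
    (h : ∀ q : PrimeSpectrum R, rankAtStalk M q = n) (p : PrimeSpectrum R) :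
    ∃ a ∉ p.asIdeal, ∀ (R' M' : Type _) [CommRing R'] [AddCommGroup M'] [Algebra R R'] [Module R M']
      [Module R' M'] [IsScalarTower R R' M'] [IsLocalization.Away a R'] (g : M →ₗ[R] M'),
      IsBaseChange R' g → Module.Free R' M' := by
  obtain ⟨a, ha, hfree⟩ := Free.away_of_finite_of_flat_of_rankAtStalk_constant M p.asIdeal
    (fun m _ ↦ by rw [h, h])
  refine ⟨a, ha, fun R' M' _ _ _ _ _ _ _ g hg ↦ ?_⟩
  let e : Localization.Away a ≃ₐ[R] R' := IsLocalization.algEquiv (Submonoid.powers a) _ _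
  let : Algebra (Localization.Away a) R' := e.toRingHom.toAlgebra
  have : IsScalarTower R (Localization.Away a) R' :=
    .of_algebraMap_eq fun r ↦ (e.commutes r).symm
  have : Module.Free (Localization.Away a) (Localization.Away a ⊗[R] M) :=
    .of_equiv (LocalizedModule.isBaseChange (Submonoid.powers a) M).equiv.symm
  -- `M'` is the base change to `R'` of the free module obtained over `Localization.Away a`.
  exact .of_equiv (TensorProduct.AlgebraTensorModule.cancelBaseChange R (Localization.Away a) R' R' M
    ≪≫ₗ hg.equiv)

end Module

namespace CommRingCat

/-- The trace of the target of a ring homomorphism over its source. -/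
noncomputable def trace {R S : CommRingCat.{0}} (φ : R ⟶ S) : S → R :=
  letI : Algebra R S := φ.hom.toAlgebra
  Algebra.trace R S

/-- A ring homomorphism whose target is a free module over its source. -/
def IsFree {R S : CommRingCat.{0}} (φ : R ⟶ S) : Prop :=
  letI : Algebra R S := φ.hom.toAlgebra
  Module.Free R S

section

variable {R S T P : CommRingCat.{0}} {f : R ⟶ S} {g : R ⟶ T} {inl : S ⟶ P} {inr : T ⟶ P}

lemma trace_of_isPushout (h : IsPushout f g inl inr) (hf : IsFree f) (_ : f.hom.Finite) (s : S) :
    trace inr (inl s) = g (trace f s) := by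
  algebraize [f.hom, g.hom, inl.hom, inr.hom, inl.hom.comp f.hom]
  have : IsScalarTower R T P := .of_algebraMap_eq' congr($(h.w).hom)
  have : Algebra.IsPushout R S T P := isPushout_iff_isPushout.mp h
  have : Algebra.IsPushout R T S P := this.symm
  have : Module.Free R S := hf
  exact Algebra.IsPushout.trace_algebraMap R S T P s

end

variable {R S : CommRingCat.{0}} (f : R ⟶ S)

lemma trace_add (s s' : S) : trace f (s + s') = trace f s + trace f s' := by
  algebraize [f.hom]
  exact map_add (Algebra.trace R S) s s'

lemma trace_smul (r : R) (s : S) : trace f (f r * s) = r * trace f s := by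
  algebraize [f.hom]
  have := map_smul (Algebra.trace R S) r s
  rwa [Algebra.smul_def] at this

lemma trace_apply (n : ℕ) (hf : IsFree f) (_ : f.hom.Finite) (hrank : ∀ x, f.hom.finrank x = n)
    (r : R) : trace f (f r) = n * r := by
  algebraize [f.hom]
  have : Module.Free R S := hf
  -- The zero ring has no prime at which to read off the rank.
  cases subsingleton_or_nontrivial R
  · exact Subsingleton.elim _ _
  · obtain ⟨x⟩ : Nonempty (PrimeSpectrum R) := inferInstance
    have h : Module.finrank R S = n := by
      rw [← hrank x]
      exact congr_fun (Module.rankAtStalk_eq_finrank_of_free (R := R) (M := S)).symm x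
    have := Algebra.trace_algebraMap (R := R) (S := S) r
    rwa [h, nsmul_eq_mul] at this

/-- Allowing any model of the localization and of the pushout lets this apply directly to sections
over a basic open. -/
lemma exists_notMem_isFree (n : ℕ) (_ : f.hom.Finite) (_ : f.hom.Flat)
    (hrank : ∀ x, f.hom.finrank x = n) (p : PrimeSpectrum R) :
    ∃ a ∉ p.asIdeal, ∀ {T P : CommRingCat.{0}} {g : R ⟶ T} {inl : S ⟶ P} {inr : T ⟶ P},
      IsPushout f g inl inr →
      (letI : Algebra R T := g.hom.toAlgebra; IsLocalization.Away a T) → IsFree inr := by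
  algebraize [f.hom]
  obtain ⟨a, ha, h⟩ := Module.exists_notMem_free_of_rankAtStalk_eq (R := R) (M := S) n hrank p
  refine ⟨a, ha, fun {T P g inl inr} sq hT ↦ ?_⟩
  algebraize [g.hom, inl.hom, inr.hom, inl.hom.comp f.hom]
  have : IsScalarTower R T P := .of_algebraMap_eq' congr($(sq.w).hom)
  have : Algebra.IsPushout R S T P := isPushout_iff_isPushout.mp sq
  have : Algebra.IsPushout R T S P := this.symm
  exact h T P _ this.out

end CommRingCat

/-! ### Sections of a finite flat morphism over affine opens. -/

namespace AlgebraicGeometry.Scheme.Hom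

variable {X Y : Scheme.{0}} (f : X ⟶ Y)

/-- For an affine morphism, sections over affine opens are compatible with restriction. -/
lemma isPushout_app [IsAffineHom f] {U V : Y.Opens} (hU : IsAffineOpen U) (hV : IsAffineOpen V)
    (i : V ⟶ U) :
    IsPushout (f.app U) (Y.presheaf.map i.op) (X.presheaf.map ((Opens.map f.base).map i).op)
      (f.app V) := by
  -- Restriction from `U` to `V` is treated as base change along the identity of `Y`, with different
  -- opens chosen at the two corners.
  have H : IsPullback (𝟙 X) f f (𝟙 Y) := .of_horiz_isIso ⟨by simp⟩
  have := (isIso_pushoutSection_iff H (US := U) (UT := V) (UX := f ⁻¹ᵁ U) (UY := f ⁻¹ᵁ V)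
    i.le le_rfl (by
      ext x
      exact ⟨fun hx ↦ ⟨i.le hx, hx⟩, fun hx ↦ hx.2⟩)).mp
    (isIso_pushoutSection_of_isAffineOpen H _ _ _ hU hV (hU.preimage f))
  simp only [Scheme.Hom.appLE, Scheme.Hom.id_app] at this
  convert this using 1 <;> simp <;> rfl

lemma flat_app [IsAffineHom f] [Flat f] {U : Y.Opens} (hU : IsAffineOpen U) :
    (f.app U).hom.Flat := by
  simpa [Scheme.Hom.appLE_eq_app] using f.flat_appLE hU (hU.preimage f) le_rfl

lemma finrank_app [IsFinite f] [Flat f] {U : Y.Opens} (hU : IsAffineOpen U)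
    (x : PrimeSpectrum Γ(Y, U)) : (f.app U).hom.finrank x = f.finrank (hU.fromSpec x) := by
  have hX := hU.preimage f
  have sq : IsPullback hX.fromSpec (Spec.map (f.app U)) f hU.fromSpec := by
    refine (IsOpenImmersion.isPullback _ _ _ _ ?_ ?_).flip
    · rw [← hU.SpecMap_appLE_fromSpec f hX le_rfl, Scheme.Hom.appLE_eq_app]
    · simp
  rw [← finrank_of_isPullback _ _ _ _ sq x, finrank_SpecMap_eq_finrank]
  · exact IsFinite.finite_app f U hU
  · exact f.flat_app hU

end AlgebraicGeometry.Scheme.Hom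

/-! ### Gluing local traces. -/

namespace AlgebraicGeometry.Scheme.Hom

variable {X Y : Scheme.{0}} (f : X ⟶ Y)

/-- An affine open `U` of `Y` such that `Γ(X, f ⁻¹ᵁ U)` is a free `Γ(Y, U)`-module. -/
structure IsTrivializing (U : Y.Opens) : Prop where
  isAffineOpen : IsAffineOpen U
  isFree : CommRingCat.IsFree (f.app U)

/-- The restriction of sections over preimages. -/
abbrev preimageRes {U V : Y.Opens} (i : V ⟶ U) : Γ(X, f ⁻¹ᵁ U) ⟶ Γ(X, f ⁻¹ᵁ V) :=
  X.presheaf.map ((Opens.map f.base).map i).op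

/-- `a` is the trace of `s`: this can be tested on trivializing affine opens. -/
def IsTraceOf {U : Y.Opens} (s : Γ(X, f ⁻¹ᵁ U)) (a : Γ(Y, U)) : Prop :=
  ∀ ⦃V : Y.Opens⦄ (i : V ⟶ U), f.IsTrivializing V →
    Y.presheaf.map i.op a = CommRingCat.trace (f.app V) (f.preimageRes i s)

variable {f}

lemma IsTrivializing.map_trace [IsFinite f] {U V : Y.Opens} (hU : f.IsTrivializing U)
    (hV : IsAffineOpen V) (i : V ⟶ U) (s : Γ(X, f ⁻¹ᵁ U)) :
    Y.presheaf.map i.op (CommRingCat.trace (f.app U) s) = CommRingCat.trace (f.app V) (f.preimageRes i s) :=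
  (CommRingCat.trace_of_isPushout (f.isPushout_app hU.isAffineOpen hV i) hU.isFree
    (IsFinite.finite_app f U hU.isAffineOpen) s).symm

lemma IsTraceOf.res {U V : Y.Opens} {s : Γ(X, f ⁻¹ᵁ U)} {a : Γ(Y, U)} (h : f.IsTraceOf s a)
    (i : V ⟶ U) : f.IsTraceOf (f.preimageRes i s) (Y.presheaf.map i.op a) := by
  intro W j hW
  rw [← CommRingCat.comp_apply, ← Functor.map_comp, ← CommRingCat.comp_apply, ← Functor.map_comp]
  exact h (j ≫ i) hW

lemma IsTrivializing.isTraceOf [IsFinite f] {U : Y.Opens} (hU : f.IsTrivializing U)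
    (s : Γ(X, f ⁻¹ᵁ U)) : f.IsTraceOf s (CommRingCat.trace (f.app U) s) :=
  fun _ i hV ↦ hU.map_trace hV.isAffineOpen i s

lemma IsTraceOf.eq_trace {U : Y.Opens} (hU : f.IsTrivializing U) {s : Γ(X, f ⁻¹ᵁ U)}
    {a : Γ(Y, U)} (h : f.IsTraceOf s a) : a = CommRingCat.trace (f.app U) s := by
  simpa [preimageRes] using h (𝟙 U) hU

lemma IsTraceOf.add {U : Y.Opens} {s s' : Γ(X, f ⁻¹ᵁ U)} {a a' : Γ(Y, U)} (h : f.IsTraceOf s a)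
    (h' : f.IsTraceOf s' a') : f.IsTraceOf (s + s') (a + a') := by
  intro V i hV
  rw [map_add, map_add, CommRingCat.trace_add, h i hV, h' i hV]

lemma IsTraceOf.smul {U : Y.Opens} {s : Γ(X, f ⁻¹ᵁ U)} {a : Γ(Y, U)} (h : f.IsTraceOf s a)
    (r : Γ(Y, U)) : f.IsTraceOf (f.app U r * s) (r * a) := by
  intro V i hV
  have : f.preimageRes i (f.app U r) = f.app V (Y.presheaf.map i.op r) :=
    (congr($(f.naturality i.op) r)).symm
  rw [map_mul, map_mul, this, CommRingCat.trace_smul, h i hV]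

section

variable [IsFinite f] [Flat f] {c : ℕ} (hdeg : ∀ y : Y, f.finrank y = c)

include hdeg

lemma exists_isTrivializing {U : Y.Opens} {y : Y} (hy : y ∈ U) :
    ∃ V : Y.Opens, y ∈ V ∧ V ≤ U ∧ f.IsTrivializing V := by
  obtain ⟨_, ⟨W, hW, rfl⟩, hyW, hWU⟩ :=
    Y.isBasis_affineOpens.exists_subset_of_mem_open hy U.isOpen
  replace hW : IsAffineOpen W := hW
  obtain ⟨p, rfl⟩ : y ∈ Set.range hW.fromSpec := by rwa [hW.range_fromSpec]
  obtain ⟨a, ha, h⟩ := CommRingCat.exists_notMem_isFree (f.app W) c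
    (IsFinite.finite_app f W hW) (f.flat_app hW) (fun x ↦ by rw [f.finrank_app hW, hdeg]) p
  have hp : p ∈ hW.fromSpec ⁻¹ᵁ Y.basicOpen a := by
    rw [hW.fromSpec_preimage_basicOpen]
    exact ha
  refine ⟨Y.basicOpen a, hp, (Y.basicOpen_le a).trans hWU, hW.basicOpen a, ?_⟩
  exact h (f.isPushout_app hW (hW.basicOpen a) (homOfLE (Y.basicOpen_le a)))
    (hW.isLocalization_basicOpen a)

lemma exists_iSup_isTrivializing (U : Y.Opens) :
    U ≤ ⨆ V : {V : Y.Opens // V ≤ U ∧ f.IsTrivializing V}, V.1 := by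
  intro y hy
  obtain ⟨V, hyV, hVU, hV⟩ := exists_isTrivializing hdeg hy
  exact Opens.mem_iSup.mpr ⟨⟨V, hVU, hV⟩, hyV⟩

lemma eq_of_forall_isTrivializing {U : Y.Opens} {a b : Γ(Y, U)}
    (h : ∀ ⦃V : Y.Opens⦄ (i : V ⟶ U), f.IsTrivializing V →
      Y.presheaf.map i.op a = Y.presheaf.map i.op b) : a = b :=
  Y.sheaf.eq_of_locally_eq' (fun V : {V : Y.Opens // V ≤ U ∧ f.IsTrivializing V} ↦ V.1) U
    (fun V ↦ homOfLE V.2.1) (exists_iSup_isTrivializing hdeg U) a b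
    (fun V ↦ h (homOfLE V.2.1) V.2.2)

lemma IsTraceOf.unique {U : Y.Opens} {s : Γ(X, f ⁻¹ᵁ U)} {a b : Γ(Y, U)} (ha : f.IsTraceOf s a)
    (hb : f.IsTraceOf s b) : a = b :=
  eq_of_forall_isTrivializing hdeg fun _ i hV ↦ (ha i hV).trans (hb i hV).symm

lemma exists_isTraceOf {U : Y.Opens} (s : Γ(X, f ⁻¹ᵁ U)) : ∃ a : Γ(Y, U), f.IsTraceOf s a := by
  obtain ⟨a, ha, -⟩ := Y.sheaf.existsUnique_gluing'
    (fun V : {V : Y.Opens // V ≤ U ∧ f.IsTrivializing V} ↦ V.1) U (fun V ↦ homOfLE V.2.1)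
    (exists_iSup_isTrivializing hdeg U)
    (fun V ↦ CommRingCat.trace (f.app V.1) (f.preimageRes (homOfLE V.2.1) s)) (fun V W ↦ by
      -- `V ⊓ W` need not be affine, so the two restrictions are compared as traces of the same
      -- section.
      refine IsTraceOf.unique hdeg (s := f.preimageRes (homOfLE (inf_le_left.trans V.2.1)) s) ?_ ?_
      · have := (V.2.2.isTraceOf (f.preimageRes (homOfLE V.2.1) s)).res
          (homOfLE (inf_le_left : V.1 ⊓ W.1 ≤ V.1))
        rw [← CommRingCat.comp_apply, ← Functor.map_comp] at this
        exact this
      · have := (W.2.2.isTraceOf (f.preimageRes (homOfLE W.2.1) s)).res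
          (homOfLE (inf_le_right : V.1 ⊓ W.1 ≤ W.1))
        rw [← CommRingCat.comp_apply, ← Functor.map_comp] at this
        exact this)
  exact ⟨a, fun V i hV ↦ ha ⟨V, i.le, hV⟩⟩

lemma isTraceOf_app {U : Y.Opens} (a : Γ(Y, U)) : f.IsTraceOf (f.app U a) (c * a) := by
  intro V i hV
  have : f.preimageRes i (f.app U a) = f.app V (Y.presheaf.map i.op a) :=
    (congr($(f.naturality i.op) a)).symm
  rw [this, CommRingCat.trace_apply _ c hV.isFree (IsFinite.finite_app f V hV.isAffineOpen)
    (fun x ↦ by rw [f.finrank_app hV.isAffineOpen, hdeg]), map_mul, map_natCast]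

end

end AlgebraicGeometry.Scheme.Hom

/-! ### The trace morphism and the splitting in cohomology. -/

namespace SchemeModules

open AlgebraicGeometry.Scheme.Hom

variable {X Y : Scheme.{0}} {f : X ⟶ Y} [IsFinite f] [Flat f] {c : ℕ}
  (hdeg : ∀ y : Y, f.finrank y = c)

/-- The trace morphism of a finite flat morphism of constant degree. -/
noncomputable def traceMorphism : directImage f ⟶ structureSheaf Y :=
  SheafOfModules.Hom.mk (PresheafOfModules.homMk
    { app := fun U ↦ AddCommGrpCat.ofHom (AddMonoidHom.mk'
        (fun s : Γ(X, f ⁻¹ᵁ U.unop) ↦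
          (show Γ(Y, U.unop) from (exists_isTraceOf (f := f) hdeg s).choose))
        (fun s s' ↦ IsTraceOf.unique hdeg (exists_isTraceOf hdeg (s + s')).choose_spec
          ((exists_isTraceOf hdeg s).choose_spec.add (exists_isTraceOf hdeg s').choose_spec)))
      naturality := fun U V i ↦ by
        ext s
        exact IsTraceOf.unique hdeg
          (exists_isTraceOf hdeg (f.preimageRes i.unop (show Γ(X, f ⁻¹ᵁ U.unop) from s))).choose_spec
          ((exists_isTraceOf hdeg (show Γ(X, f ⁻¹ᵁ U.unop) from s)).choose_spec.res i.unop) }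
    (fun U r s ↦ IsTraceOf.unique hdeg (exists_isTraceOf hdeg _).choose_spec
      ((exists_isTraceOf hdeg (show Γ(X, f ⁻¹ᵁ U.unop) from s)).choose_spec.smul
        (show Γ(Y, U.unop) from r))))

lemma isTraceOf_traceMorphism {U : Y.Opens} (s : Γ(X, f ⁻¹ᵁ U)) :
    f.IsTraceOf s ((traceMorphism hdeg).app U s) :=
  (exists_isTraceOf hdeg s).choose_spec

lemma isTraceMorphism_traceMorphism : IsTraceMorphism f (traceMorphism hdeg) :=
  fun _ hU hfree s ↦ (isTraceOf_traceMorphism hdeg s).eq_trace ⟨hU, hfree⟩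

omit [IsFinite f] [Flat f] in
-- Naturality carries the condition on trivializing opens to sections over arbitrary opens.
lemma IsTraceMorphism.isTraceOf {t : directImage f ⟶ structureSheaf Y} (ht : IsTraceMorphism f t)
    {U : Y.Opens} (s : Γ(X, f ⁻¹ᵁ U)) : f.IsTraceOf s (t.app U s) := by
  intro V i hV
  have h₁ : Y.presheaf.map i.op (t.app U s) = t.app V (f.preimageRes i s) :=
    (congr($(t.mapPresheaf.naturality i.op) s)).symm
  rw [h₁]
  exact ht V hV.isAffineOpen hV.isFree _

include hdeg in
lemma IsTraceMorphism.unique {t t' : directImage f ⟶ structureSheaf Y} (ht : IsTraceMorphism f t)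
    (ht' : IsTraceMorphism f t') : t = t' := by
  ext U s
  exact IsTraceOf.unique hdeg (ht.isTraceOf s) (ht'.isTraceOf s)

section Complex

variable [Y.Over (Spec (.of ℂ))]

lemma structureMap_comp_smul_traceMorphism (hc : c ≠ 0) :
    structureMap f ≫ ((c : ℂ)⁻¹ • traceMorphism hdeg) = 𝟙 (structureSheaf Y) := by
  ext U a
  have h : (traceMorphism hdeg).app U (f.app U (show Γ(Y, U) from a)) =
      (c : Γ(Y, U)) * (show Γ(Y, U) from a) :=
    IsTraceOf.unique hdeg (isTraceOf_traceMorphism hdeg _) (isTraceOf_app hdeg _)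
  change scalars Y U (c : ℂ)⁻¹ * (show Γ(Y, U) from
    (traceMorphism hdeg).app U (f.app U (show Γ(Y, U) from a))) = (show Γ(Y, U) from a)
  -- The cancellation takes place in `ℂ`, before mapping to `Γ(Y, U)`.
  rw [h, ← mul_assoc, ← map_natCast (scalars Y U) c, ← map_mul,
    inv_mul_cancel₀ (Nat.cast_ne_zero.mpr hc), map_one, one_mul]

lemma cohomologyMap_id (q : ℕ) (M : Y.Modules) : cohomologyMap q (𝟙 M) = LinearMap.id := by
  ext x
  exact congr(($((cohomologyFunctor Y q).map_id M)).hom x)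

lemma cohomologyMap_comp (q : ℕ) {M N K : Y.Modules} (φ : M ⟶ N) (ψ : N ⟶ K) :
    cohomologyMap q ψ ∘ₗ cohomologyMap q φ = cohomologyMap q (φ ≫ ψ) := by
  ext x
  exact congr(($((cohomologyFunctor Y q).map_comp φ ψ)).hom x).symm

end Complex

lemma tensorMap_comp {Y : Scheme.{0}} (M : Y.Modules) {N N' N'' : Y.Modules} (φ : N ⟶ N')
    (ψ : N' ⟶ N'') : tensorMap M φ ≫ tensorMap M ψ = tensorMap M (φ ≫ ψ) := by
  refine ((sheafification Y).map_comp _ _).symm.trans ?_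
  rw [← MonoidalCategory.whiskerLeft_comp, ← Functor.map_comp]
  rfl

lemma tensorMap_id {Y : Scheme.{0}} (M N : Y.Modules) :
    tensorMap M (𝟙 N) = 𝟙 (tensorProduct M N) := by
  simp [tensorMap, tensorProduct]

end SchemeModules

/-- Finite flat morphisms of degree `c ≥ 1` between schemes over `ℂ`: for every locally free sheaf
`L` on `Y`, `H^q(Y, L)` is a direct summand of `H^q(Y, L ⊗ f_* 𝒪_X)`, the splitting being given by
the trace morphism divided by `c`. -/
theorem proposition5p7 {X Y : Scheme.{0}} [X.Over (Spec (.of ℂ))] [Y.Over (Spec (.of ℂ))]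
    (f : X ⟶ Y) [f.IsOver (Spec (.of ℂ))] [IsFinite f] [Flat f]
    (c : ℕ) (hc : 0 < c) (hdeg : ∀ y : Y, f.finrank y = c) :
    (∀ (L : Y.Modules) [SheafOfModules.IsLocallyFree L] (q : ℕ),
      SchemeModules.IsDirectSummand ℂ (SchemeModules.Cohomology q L)
        (SchemeModules.Cohomology q (SchemeModules.tensorProduct L (SchemeModules.directImage f)))) ∧
    ∃ t : SchemeModules.directImage f ⟶ SchemeModules.structureSheaf Y,
      SchemeModules.IsTraceMorphism f t ∧
      (∀ t', SchemeModules.IsTraceMorphism f t' → t' = t) ∧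
      SchemeModules.structureMap f ≫ ((c : ℂ)⁻¹ • t) = 𝟙 (SchemeModules.structureSheaf Y) ∧
      ∀ (L : Y.Modules) [SheafOfModules.IsLocallyFree L] (q : ℕ),
        SchemeModules.cohomologyMap q
            (SchemeModules.tensorMap L ((c : ℂ)⁻¹ • t) ≫ (SchemeModules.tensorUnitIso L).hom) ∘ₗ
          SchemeModules.cohomologyMap q
            ((SchemeModules.tensorUnitIso L).inv ≫
              SchemeModules.tensorMap L (SchemeModules.structureMap f)) =
        LinearMap.id := by
  have split (L : Y.Modules) (q : ℕ) :
      SchemeModules.cohomologyMap q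
          (SchemeModules.tensorMap L ((c : ℂ)⁻¹ • SchemeModules.traceMorphism hdeg) ≫
            (SchemeModules.tensorUnitIso L).hom) ∘ₗ
        SchemeModules.cohomologyMap q
          ((SchemeModules.tensorUnitIso L).inv ≫
            SchemeModules.tensorMap L (SchemeModules.structureMap f)) =
      LinearMap.id := by
    rw [SchemeModules.cohomologyMap_comp, Category.assoc,
      reassoc_of% SchemeModules.tensorMap_comp,
      SchemeModules.structureMap_comp_smul_traceMorphism hdeg hc.ne', SchemeModules.tensorMap_id,
      Category.id_comp, Iso.inv_hom_id, SchemeModules.cohomologyMap_id]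
  exact ⟨fun L _ q ↦ ⟨_, _, split L q⟩, SchemeModules.traceMorphism hdeg,
    SchemeModules.isTraceMorphism_traceMorphism hdeg,
    fun t' ht' ↦ ht'.unique hdeg (SchemeModules.isTraceMorphism_traceMorphism hdeg),
    SchemeModules.structureMap_comp_smul_traceMorphism hdeg hc.ne', fun L _ q ↦ split L q⟩
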